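/- Let $m$ be a positive integer with $m\equiv 0 \bmod 4$, and write $m=4n$. Let $M=\mathbb{CP}^{2n}\setminus\mathbb{CP}^{2n-1}$ be complex projective space minus a hyperplane, a manifold of real dimension $m$, with the Fubini–Study metric $g$ (normalized to holomorphic sectional curvature $4$), its standard complex structure $J_1$, Levi-Civita connection $\nabla$ and curvature $$\mathcal R(x,y)=\nabla_x\nabla_y-\nabla_y\nabla_x-\nabla_{[x,y]},\qquad R(x,y,z,w)=g(\mathcal R(x,y)z,w).$$ Then there are smooth $g$-orthogonal almost complex structures $J_2,J_3$ on $M$ with $J_1J_2=-J_2J_1=J_3$, so that $(M,g,J_2)$ is an almost Hermitian manifold of dimension $m$, such that $$\Theta=\tfrac1{\sqrt2}\,(1+J_2)$$ is a smooth section of the bundle of complex isometries of $(TM,g,J_2)$ (that is, every $\theta_P=\Theta(P)$ is a linear isometry of $(T_PM,g_P)$ commuting with $J_2$) with the following properties at every point $P\in M$. A complex line in $T_PM$ is a real $2$-plane $\pi$ with $J_2\pi=\pi$. For such $\pi$ and any unit vector $x\in\pi$ put $$\mathcal J(\pi)y=\mathcal R(y,x)x+\mathcal R(y,J_2x)J_2x,\qquad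 \mathcal R(\pi)y=\mathcal R(x,J_2x)y \qquad (y\in T_PM);$$ these operators do not depend on the choice of $x$. Then: 1. $\theta_P\,\mathcal J(\pi)=\mathcal J(\theta_P\pi)\,\theta_P$ for all complex lines $\pi$ in $T_PM$; 2. $\theta_P\,\mathcal R(\pi)=\mathcal R(\theta_P\pi)\,\theta_P$ for all complex lines $\pi$ in $T_PM$; 3. $\theta_P^*R_P\neq R_P$, where $\theta_P^*R_P(x,y,z,w)=R_P(\theta_Px,\theta_Py,\theta_Pz,\theta_Pw)$. -/

import Mathlib

open Bundle Manifold ContDiff Topology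
open scoped LinearAlgebra.Projectivization

noncomputable section

namespace AlmostHermitian

/-! ### Riemannian geometry on a smooth manifold -/

section General

variable {E : Type*} [NormedAddCommGroup E] [NormedSpace ℝ E]
  {H : Type*} [TopologicalSpace H] (I : ModelWithCorners ℝ E H)
  (M : Type*) [TopologicalSpace M] [ChartedSpace H M] [IsManifold I ∞ M]

/-- Smooth Riemannian metrics on `M`. -/
abbrev Metric : Type _ :=
  ContMDiffRiemannianMetric I ∞ E (fun x : M ↦ TangentSpace I x)

variable {I M}

/-- A field `A` of endomorphisms of the tangent spaces is smooth. -/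
def SmoothEndField (A : ∀ x : M, TangentSpace I x →L[ℝ] TangentSpace I x) : Prop :=
  ContMDiff I (I.prod 𝓘(ℝ, E →L[ℝ] E)) ∞
    (fun x ↦ TotalSpace.mk' (E →L[ℝ] E)
      (E := fun x : M ↦ TangentSpace I x →L[ℝ] TangentSpace I x) x (A x))

/-- A smooth unitary almost complex structure on the Riemannian manifold `(M, g)`; with such a `J`,
the triple `(M, g, J)` is an almost Hermitian manifold. -/
structure UnitaryAlmostComplexStructure (g : Metric I M) where
  toFun : ∀ x : M, TangentSpace I x →L[ℝ] TangentSpace I x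
  smooth : SmoothEndField toFun
  sq : ∀ (x : M) (v : TangentSpace I x), toFun x (toFun x v) = -v
  isometry : ∀ (x : M) (v w : TangentSpace I x),
    g.inner x (toFun x v) (toFun x w) = g.inner x v w

instance (g : Metric I M) : CoeFun (UnitaryAlmostComplexStructure g)
    (fun _ ↦ ∀ x : M, TangentSpace I x →L[ℝ] TangentSpace I x) :=
  ⟨fun J ↦ J.toFun⟩

/-- `{J₁, J₂, J₃}` is a (unitary) quaternion structure on the tangent bundle. -/
def IsQuaternionStructure {g : Metric I M} (J₁ J₂ J₃ : UnitaryAlmostComplexStructure g) : Prop :=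
  ∀ (x : M) (v : TangentSpace I x), J₁ x (J₂ x v) = J₃ x v ∧ J₂ x (J₁ x v) = -J₃ x v

/-- A smooth section of the bundle of complex isometries of `(TM, g, J)`. -/
structure ComplexIsometryField {g : Metric I M} (J : UnitaryAlmostComplexStructure g) where
  toFun : ∀ x : M, TangentSpace I x ≃L[ℝ] TangentSpace I x
  smooth : SmoothEndField (fun x ↦ (toFun x : TangentSpace I x →L[ℝ] TangentSpace I x))
  isometry : ∀ (x : M) (v w : TangentSpace I x),
    g.inner x (toFun x v) (toFun x w) = g.inner x v w
  commutes : ∀ (x : M) (v : TangentSpace I x), toFun x (J x v) = J x (toFun x v)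

instance {g : Metric I M} (J : UnitaryAlmostComplexStructure g) :
    CoeFun (ComplexIsometryField J) (fun _ ↦ ∀ x : M, TangentSpace I x ≃L[ℝ] TangentSpace I x) :=
  ⟨fun Θ ↦ Θ.toFun⟩

variable (I M) in
/-- Affine connections on `M`. The value of `cov Y x v` is `(∇_v Y)(x)`. -/
abbrev Connection : Type _ := CovariantDerivative I E (fun x : M ↦ TangentSpace I x)

/-- `∇` is the Levi-Civita connection of `g`: it is torsion free and `∇ g = 0`. -/
structure IsLeviCivita (g : Metric I M) (cov : Connection I M) : Prop where
  torsion_free : ∀ (X Y : ∀ x : M, TangentSpace I x) (x : M),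
    MDiffAt (T% X) x → MDiffAt (T% Y) x →
      cov Y x (X x) - cov X x (Y x) = VectorField.mlieBracket I X Y x
  metric : ∀ (Y Z : ∀ x : M, TangentSpace I x) (x : M) (v : TangentSpace I x),
    MDiffAt (T% Y) x → MDiffAt (T% Z) x →
      mvfderiv I (fun y ↦ g.inner y (Y y) (Z y)) x v =
        g.inner x (cov Y x v) (Z x) + g.inner x (Y x) (cov Z x v)

/-- `∇_X ∇_Y Z - ∇_Y ∇_X Z - ∇_{[X, Y]} Z` for vector fields `X`, `Y`, `Z`. -/
def curvatureOfFields (cov : Connection I M) (X Y Z : ∀ x : M, TangentSpace I x) (x : M) :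
    TangentSpace I x :=
  cov (fun y ↦ cov Z y (Y y)) x (X x) - cov (fun y ↦ cov Z y (X y)) x (Y x)
    - cov Z x (VectorField.mlieBracket I X Y x)

/-- The curvature operator `ℛ(u, v) w` at the point `x`, computed by extending the three tangent
vectors to vector fields which are smooth near `x` (the result does not depend on the extension
when the connection is smooth, in particular for a Levi-Civita connection). -/
def curvature (cov : Connection I M) {x : M} (u v w : TangentSpace I x) : TangentSpace I x :=
  curvatureOfFields cov (FiberBundle.extend E u) (FiberBundle.extend E v)
    (FiberBundle.extend E w) x

/-- The curvature tensor `R(x, y, z, w) = g(ℛ(x, y) z, w)` at the point `P`. -/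
def curvatureTensor (g : Metric I M) (cov : Connection I M) (P : M)
    (x y z w : TangentSpace I P) : ℝ :=
  g.inner P (curvature cov x y z) w

/-- The Jacobi operator `𝒥(x) : y ↦ ℛ(y, x) x`. -/
def jacobi (cov : Connection I M) {P : M} (x y : TangentSpace I P) : TangentSpace I P :=
  curvature cov y x x

/-- `L ⊆ T_P M` is a complex line for `J`: a real plane with `J L = L`. -/
def IsComplexLine {g : Metric I M} (J : UnitaryAlmostComplexStructure g) (P : M)
    (L : Submodule ℝ (TangentSpace I P)) : Prop :=
  Module.finrank ℝ L = 2 ∧ L.map (J P).toLinearMap = L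

/-- The set `S(L)` of unit vectors in `L`. -/
def unitVectors (g : Metric I M) {P : M} (L : Submodule ℝ (TangentSpace I P)) :
    Set (TangentSpace I P) :=
  {x | x ∈ L ∧ g.inner P x x = 1}

/-- The complex Jacobi operator `𝒥(L) = 𝒥(x) + 𝒥(J x)` of the complex line `L` spanned by `x` and
`J x`, computed from a unit vector `x ∈ S(L)`. -/
def complexJacobi {g : Metric I M} (J : UnitaryAlmostComplexStructure g) (cov : Connection I M)
    {P : M} (x y : TangentSpace I P) : TangentSpace I P :=
  jacobi cov x y + jacobi cov (J P x) y

/-- The complex curvature operator `ℛ(L) = ℛ(x, J x)` of the complex line `L` spanned by `x` and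
`J x`, computed from a unit vector `x ∈ S(L)`. -/
def complexCurvature {g : Metric I M} (J : UnitaryAlmostComplexStructure g) (cov : Connection I M)
    {P : M} (x y : TangentSpace I P) : TangentSpace I P :=
  curvature cov x (J P x) y

end General

/-! ### Complex projective space minus a hyperplane -/

/-- `ℂᵏ`. It is a real vector space of dimension `2 k`. -/
abbrev Cplx (k : ℕ) : Type := EuclideanSpace ℂ (Fin k)

/-- The space of complex lines through the origin of `ℂᵏ⁺¹`. -/
abbrev CP (k : ℕ) : Type := ℙ ℂ (Fin (k + 1) → ℂ)

/-- Complex projective space carries the quotient topology. -/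
instance (k : ℕ) : TopologicalSpace (CP k) :=
  inferInstanceAs (TopologicalSpace (Quotient (projectivizationSetoid ℂ (Fin (k + 1) → ℂ))))

/-- The hyperplane `ℂPᵏ⁻¹ ⊆ ℂPᵏ`, image of `ℂᵏ ⊆ ℂᵏ⁺¹`: the lines on which the last homogeneous
coordinate vanishes. -/
def hyperplane (k : ℕ) : Set (CP k) :=
  {p | ∀ v ∈ p.submodule, v (Fin.last k) = 0}

/-- `ℂPᵏ` minus the hyperplane `ℂPᵏ⁻¹`, with the subspace topology. -/
abbrev AffineCP (k : ℕ) : Type := {p : CP k // p ∉ hyperplane k}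

lemma mk_mem_hyperplane {k : ℕ} (v : Fin (k + 1) → ℂ) (hv : v ≠ 0) :
    Projectivization.mk ℂ v hv ∈ hyperplane k ↔ v (Fin.last k) = 0 := by
  simp only [hyperplane, Set.mem_ofPred_eq, Projectivization.submodule_mk]
  constructor
  · intro h
    exact h v (Submodule.mem_span_singleton_self v)
  · intro h w hw
    obtain ⟨a, rfl⟩ := Submodule.mem_span_singleton.1 hw
    simp [h]

/-- The affine coordinates `[v₀ : … : v_k] ↦ (v₀ / v_k, …, v_{k-1} / v_k)`. -/
def affineCoord (k : ℕ) (p : CP k) : Cplx k :=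
  Projectivization.lift (fun v : {v : Fin (k + 1) → ℂ // v ≠ 0} ↦
    WithLp.toLp 2 fun i : Fin k ↦ v.1 i.castSucc / v.1 (Fin.last k)) (by
    rintro ⟨a, ha⟩ ⟨b, hb⟩ t (rfl : a = t • b)
    have ht : t ≠ 0 := by rintro rfl; simp at ha
    ext i
    simp [mul_div_mul_left _ _ ht]) p

/-- The inverse of the affine coordinates, `z ↦ [z₀ : … : z_{k-1} : 1]`. -/
def affinePoint (k : ℕ) (z : Cplx k) : AffineCP k :=
  ⟨Projectivization.mk ℂ (Fin.snoc (α := fun _ ↦ ℂ) z.ofLp 1)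
      (fun h ↦ by simpa using congrFun h (Fin.last k)),
    by simp [mk_mem_hyperplane]⟩

lemma affinePoint_affineCoord (k : ℕ) (p : AffineCP k) : affinePoint k (affineCoord k p.1) = p := by
  obtain ⟨p, hp⟩ := p
  induction p using Projectivization.ind with
  | h v hv =>
    rw [mk_mem_hyperplane] at hp
    apply Subtype.ext
    simp only [affinePoint, affineCoord, Projectivization.lift_mk]
    rw [Projectivization.mk_eq_mk_iff']
    refine ⟨(v (Fin.last k))⁻¹, ?_⟩
    ext i
    refine Fin.lastCases ?_ (fun i ↦ ?_) i
    · simp [hp]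
    · simp [div_eq_inv_mul]

lemma affineCoord_affinePoint (k : ℕ) (z : Cplx k) : affineCoord k (affinePoint k z).1 = z := by
  ext i
  simp [affinePoint, affineCoord]

/-- The affine coordinates identify `ℂPᵏ` minus the hyperplane with `ℂᵏ`. -/
def affineHomeomorph (k : ℕ) : AffineCP k ≃ₜ Cplx k where
  toFun p := affineCoord k p.1
  invFun := affinePoint k
  left_inv := affinePoint_affineCoord k
  right_inv := affineCoord_affinePoint k
  continuous_toFun := by
    have hq : IsQuotientMap (fun v : {v : Fin (k + 1) → ℂ // v ≠ 0} ↦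
        Projectivization.mk ℂ v.1 v.2) := isQuotientMap_quot_mk
    have hpre : (fun v : {v : Fin (k + 1) → ℂ // v ≠ 0} ↦ Projectivization.mk ℂ v.1 v.2) ⁻¹'
        (hyperplane k)ᶜ = {v | v.1 (Fin.last k) ≠ 0} := by
      ext v
      simp [mk_mem_hyperplane]
    have ho : IsOpen (hyperplane k)ᶜ := by
      rw [← hq.isOpen_preimage, hpre]
      exact isOpen_ne_fun ((continuous_apply _).comp continuous_subtype_val) continuous_const
    have hr := hq.restrictPreimage_isOpen ho
    refine (hr.continuous_iff (g := fun p : ((hyperplane k)ᶜ : Set (CP k)) ↦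
      affineCoord k p.1)).2 ?_
    refine (PiLp.continuous_toLp 2 _).comp (continuous_pi fun i ↦ ?_)
    have hc (j : Fin (k + 1)) : Continuous fun v : ((fun v : {v : Fin (k + 1) → ℂ // v ≠ 0} ↦
        Projectivization.mk ℂ v.1 v.2) ⁻¹' (hyperplane k)ᶜ) ↦ v.1.1 j :=
      (continuous_apply j).comp (continuous_subtype_val.comp continuous_subtype_val)
    refine Continuous.div (hc _) (hc _) ?_
    rintro ⟨v, hv⟩
    rw [hpre] at hv
    exact hv
  continuous_invFun := by
    refine Continuous.subtype_mk (continuous_quot_mk.comp (Continuous.subtype_mk ?_ _)) _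
    exact Continuous.finSnoc (by fun_prop) continuous_const

/-- The smooth structure on `ℂPᵏ` minus the hyperplane given by the affine coordinates, which form
a single global chart. In this chart every tangent space is `ℂᵏ`. -/
instance (k : ℕ) : ChartedSpace (Cplx k) (AffineCP k) :=
  (affineHomeomorph k).toOpenPartialHomeomorph.singletonChartedSpace rfl

instance (k : ℕ) (n : ℕ∞ω) : IsManifold 𝓘(ℝ, Cplx k) n (AffineCP k) :=
  (affineHomeomorph k).toOpenPartialHomeomorph.isManifold_singleton rfl

/-- The tangent space of `ℂPᵏ` minus the hyperplane at `p`. -/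
abbrev Tan {k : ℕ} (p : AffineCP k) : Type := TangentSpace 𝓘(ℝ, Cplx k) p

lemma contMDiff_affineCoord (k : ℕ) :
    ContMDiff 𝓘(ℝ, Cplx k) 𝓘(ℝ, Cplx k) ∞ (fun p : AffineCP k ↦ affineCoord k p.1) := by
  intro p
  exact contMDiffAt_extChartAt (I := 𝓘(ℝ, Cplx k)) (x := p)

/-- The identification of the tangent space at `p` with `ℂᵏ` through the affine coordinates. -/
def tangentEquiv {k : ℕ} (p : AffineCP k) : Tan p ≃L[ℝ] Cplx k :=
  ContinuousLinearEquiv.refl ℝ (Cplx k)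

lemma continuousLinearMapAt_eq {k : ℕ} (p q : AffineCP k) :
    (trivializationAt (Cplx k) (TangentSpace 𝓘(ℝ, Cplx k)) p).continuousLinearMapAt ℝ q =
      (tangentEquiv q : Tan q →L[ℝ] Cplx k) := by
  rw [TangentBundle.continuousLinearMapAt_trivializationAt_eq_core (Set.mem_univ q)]
  ext1 v
  exact (tangentBundleCore 𝓘(ℝ, Cplx k) (AffineCP k)).coordChange_self (achart (Cplx k) p) q
    (Set.mem_univ q) v

lemma symmL_eq {k : ℕ} (p q : AffineCP k) :
    (trivializationAt (Cplx k) (TangentSpace 𝓘(ℝ, Cplx k)) p).symmL ℝ q =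
      ((tangentEquiv q).symm : Cplx k →L[ℝ] Tan q) := by
  rw [TangentBundle.symmL_trivializationAt_eq_core (Set.mem_univ q)]
  ext1 v
  exact (tangentBundleCore 𝓘(ℝ, Cplx k) (AffineCP k)).coordChange_self (achart (Cplx k) p) q
    (Set.mem_univ q) v

/-- Smoothness of a field of endomorphisms can be checked in the affine coordinates. -/
lemma smoothEndField_of_contMDiff {k : ℕ} (A : AffineCP k → (Cplx k →L[ℝ] Cplx k))
    (hA : ContMDiff 𝓘(ℝ, Cplx k) 𝓘(ℝ, Cplx k →L[ℝ] Cplx k) ∞ A) :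
    SmoothEndField (I := 𝓘(ℝ, Cplx k)) (fun p : AffineCP k ↦
      ((tangentEquiv p).symm : Cplx k →L[ℝ] Tan p) ∘L A p ∘L (tangentEquiv p : Tan p →L[ℝ] Cplx k)) := by
  intro p
  rw [contMDiffAt_section]
  convert! hA p
  ext1 v
  rw [hom_trivializationAt_apply]
  simp only [ContinuousLinearMap.inCoordinates, continuousLinearMapAt_eq, symmL_eq]
  simp

/-- The Fubini–Study inner product at the point with affine coordinates `z`,
`Re (((1 + |z|²) ⟨u, w⟩ - ⟨u, z⟩ ⟨z, w⟩) / (1 + |z|²)²)`. With this normalization the holomorphic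
sectional curvature is `4`. -/
def fubiniStudyForm {k : ℕ} (z : Cplx k) : Cplx k →L[ℝ] Cplx k →L[ℝ] ℝ :=
  (LinearMap.mk₂ ℝ (fun u w : Cplx k ↦
    (((1 + (‖z‖ : ℂ) ^ 2) * inner ℂ u w - inner ℂ u z * inner ℂ z w) /
      (1 + (‖z‖ : ℂ) ^ 2) ^ 2).re)
    (by
      intro u u' w
      rw [← Complex.add_re]; congr 1
      simp only [inner_add_left]; ring)
    (by
      intro c u w
      rw [smul_eq_mul, ← Complex.re_ofReal_mul]; congr 1
      simp only [← Complex.coe_smul, inner_smul_left, Complex.conj_ofReal]; ring)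
    (by
      intro u w w'
      rw [← Complex.add_re]; congr 1
      simp only [inner_add_right]; ring)
    (by
      intro c u w
      rw [smul_eq_mul, ← Complex.re_ofReal_mul]; congr 1
      simp only [← Complex.coe_smul, inner_smul_right]; ring)).toContinuousBilinearMap

lemma fubiniStudyForm_apply {k : ℕ} (z u w : Cplx k) :
    fubiniStudyForm z u w =
      (((1 + (‖z‖ : ℂ) ^ 2) * inner ℂ u w - inner ℂ u z * inner ℂ z w) /
        (1 + (‖z‖ : ℂ) ^ 2) ^ 2).re := rfl

lemma fubiniStudyForm_symm {k : ℕ} (z u w : Cplx k) :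
    fubiniStudyForm z u w = fubiniStudyForm z w u := by
  rw [fubiniStudyForm_apply, fubiniStudyForm_apply, ← Complex.conj_re]
  congr 1
  simp only [map_div₀, map_sub, map_mul, map_add, map_pow, map_one, Complex.conj_ofReal,
    inner_conj_symm]
  ring

lemma le_fubiniStudyForm {k : ℕ} (z u : Cplx k) :
    ‖u‖ ^ 2 / (1 + ‖z‖ ^ 2) ^ 2 ≤ fubiniStudyForm z u u := by
  have h1 : inner ℂ u z * inner ℂ z u = ((‖inner ℂ z u‖ ^ 2 : ℝ) : ℂ) := by
    rw [← inner_conj_symm u z, Complex.conj_mul']; norm_cast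
  have h2 : ‖inner ℂ z u‖ ≤ ‖z‖ * ‖u‖ := norm_inner_le_norm z u
  have h3 : fubiniStudyForm z u u =
      ((1 + ‖z‖ ^ 2) * ‖u‖ ^ 2 - ‖inner ℂ z u‖ ^ 2) / (1 + ‖z‖ ^ 2) ^ 2 := by
    rw [fubiniStudyForm_apply, h1, inner_self_eq_norm_sq_to_K]
    rw [← Complex.ofReal_re (((1 + ‖z‖ ^ 2) * ‖u‖ ^ 2 - ‖inner ℂ z u‖ ^ 2) / (1 + ‖z‖ ^ 2) ^ 2)]
    congr 1
    push_cast
    rfl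
  rw [h3]
  gcongr
  have := pow_le_pow_left₀ (norm_nonneg _) h2 2
  nlinarith

lemma contDiff_fubiniStudyForm (k : ℕ) :
    ContDiff ℝ ∞ (fun z : Cplx k ↦ fubiniStudyForm z) := by
  rw [contDiff_clm_apply_iff]
  intro u
  rw [contDiff_clm_apply_iff]
  intro w
  simp only [fubiniStudyForm_apply]
  have hn : ContDiff ℝ ∞ (fun z : Cplx k ↦ (1 + (‖z‖ : ℂ) ^ 2)) := by
    have h : ContDiff ℝ ∞ (fun z : Cplx k ↦ ((1 + ‖z‖ ^ 2 : ℝ) : ℂ)) :=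
      
        Complex.ofRealCLM.contDiff.comp
          (contDiff_const.add (contDiff_norm_sq ℝ (E := Cplx k) (n := ∞)))
    simpa using h
  have h1 : ContDiff ℝ ∞ (fun z : Cplx k ↦ inner ℂ z w) := contDiff_id.inner ℂ contDiff_const
  have h2 : ContDiff ℝ ∞ (fun z : Cplx k ↦ inner ℂ u z) := contDiff_const.inner ℂ contDiff_id
  have hre : ContDiff ℝ ∞ Complex.re := Complex.reCLM.contDiff
  refine hre.comp ?_
  simp only [div_eq_mul_inv]
  refine ((hn.mul contDiff_const).sub (h2.mul h1)).mul ((hn.pow 2).inv fun z ↦ ?_)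
  have : (1 + (‖z‖ : ℂ) ^ 2) = ((1 + ‖z‖ ^ 2 : ℝ) : ℂ) := by simp
  rw [this, ← Complex.ofReal_pow, Complex.ofReal_ne_zero]
  positivity

/-- The Fubini–Study inner product on the tangent space at `p`. -/
def fubiniStudyInner {k : ℕ} (p : AffineCP k) : Tan p →L[ℝ] Tan p →L[ℝ] ℝ :=
  ContinuousLinearMap.precomp ℝ (tangentEquiv p : Tan p →L[ℝ] Cplx k) ∘L
    fubiniStudyForm (affineCoord k p.1) ∘L (tangentEquiv p : Tan p →L[ℝ] Cplx k)

lemma fubiniStudyInner_apply {k : ℕ} (p : AffineCP k) (u w : Tan p) :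
    fubiniStudyInner p u w =
      fubiniStudyForm (affineCoord k p.1) (tangentEquiv p u) (tangentEquiv p w) := rfl

lemma fubiniStudyInner_isVonNBounded {k : ℕ} (p : AffineCP k) :
    Bornology.IsVonNBounded ℝ {u : Tan p | fubiniStudyInner p u u < 1} := by
  have hb : Bornology.IsVonNBounded ℝ (Metric.ball (0 : Cplx k) (1 + ‖affineCoord k p.1‖ ^ 2)) :=
    NormedSpace.isVonNBounded_ball ℝ (Cplx k) _
  have hb' := hb.image ((tangentEquiv p).symm : Cplx k →L[ℝ] Tan p)
  refine hb'.subset ?_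
  intro u hu
  refine ⟨tangentEquiv p u, ?_, by simp⟩
  rw [Set.mem_ofPred_eq, fubiniStudyInner_apply] at hu
  have h := (le_fubiniStudyForm (affineCoord k p.1) (tangentEquiv p u)).trans_lt hu
  rw [div_lt_one (by positivity)] at h
  rw [Metric.mem_ball, dist_zero_right]
  exact lt_of_pow_lt_pow_left₀ 2 (by positivity) h

lemma contMDiff_fubiniStudyInner (k : ℕ) :
    ContMDiff 𝓘(ℝ, Cplx k) (𝓘(ℝ, Cplx k).prod 𝓘(ℝ, Cplx k →L[ℝ] Cplx k →L[ℝ] ℝ)) ∞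
      (fun p : AffineCP k ↦ TotalSpace.mk' (Cplx k →L[ℝ] Cplx k →L[ℝ] ℝ)
        (E := fun p : AffineCP k ↦ Tan p →L[ℝ] Tan p →L[ℝ] ℝ) p (fubiniStudyInner p)) := by
  intro p
  rw [contMDiffAt_section]
  convert! ((contDiff_fubiniStudyForm k).contMDiff.comp (contMDiff_affineCoord k)) p
  rename_i q
  ext v w
  rw [hom_trivializationAt_apply]
  simp only [ContinuousLinearMap.inCoordinates, symmL_eq]
  simp [hom_trivializationAt_apply, ContinuousLinearMap.inCoordinates, symmL_eq,
    fubiniStudyInner_apply]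

/-- The Fubini–Study metric on `ℂPᵏ` minus the hyperplane. -/
def fubiniStudy (k : ℕ) : Metric 𝓘(ℝ, Cplx k) (AffineCP k) where
  inner p := fubiniStudyInner p
  symm p u w := fubiniStudyForm_symm _ _ _
  pos p u hu := by
    have h := le_fubiniStudyForm (affineCoord k p.1) (tangentEquiv p u)
    rw [fubiniStudyInner_apply]
    refine lt_of_lt_of_le ?_ h
    have : 0 < ‖tangentEquiv p u‖ := by simpa using hu
    positivity
  isVonNBounded := fubiniStudyInner_isVonNBounded
  contMDiff := contMDiff_fubiniStudyInner k

/-- Multiplication by `i` on `ℂᵏ`, as a real linear map. -/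
def mulI (k : ℕ) : Cplx k →L[ℝ] Cplx k :=
  (Complex.I • ContinuousLinearMap.id ℂ (Cplx k)).restrictScalars ℝ

lemma mulI_apply {k : ℕ} (v : Cplx k) : mulI k v = Complex.I • v := rfl

/-- The standard complex structure of `ℂPᵏ` minus the hyperplane: multiplication by `i` in the
affine coordinates. -/
def standardJ (k : ℕ) : UnitaryAlmostComplexStructure (fubiniStudy k) where
  toFun p := ((tangentEquiv p).symm : Cplx k →L[ℝ] Tan p) ∘L mulI k ∘L
    (tangentEquiv p : Tan p →L[ℝ] Cplx k)
  smooth := smoothEndField_of_contMDiff _ contMDiff_const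
  sq p v := by
    apply (tangentEquiv p).injective
    simp [mulI_apply, smul_smul]
  isometry p v w := by
    change fubiniStudyForm _ (Complex.I • tangentEquiv p v) (Complex.I • tangentEquiv p w) =
      fubiniStudyForm _ (tangentEquiv p v) (tangentEquiv p w)
    simp only [fubiniStudyForm_apply, inner_smul_left, inner_smul_right, Complex.conj_I]
    congr 2
    linear_combination (-1 : ℂ) * ((1 + (‖affineCoord k p.1‖ : ℂ) ^ 2) *
      inner ℂ (tangentEquiv p v) (tangentEquiv p w) -
      inner ℂ (tangentEquiv p v) (affineCoord k p.1) *
        inner ℂ (affineCoord k p.1) (tangentEquiv p w)) * Complex.I_mul_I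

end AlmostHermitian

end

open AlmostHermitian

noncomputable section

namespace AlmostHermitian

/-! The metric has constant holomorphic sectional curvature 4, so its curvature is an explicit
expression in `g` and `J₁` (`curvature_fubiniStudyConnection`). Let K = `J₂` anticommute with `J₁`,
and let π be the K-line of a unit vector x. Since x, Kx, J₁x, J₁Kx are orthonormal, the complex
Jacobi operator of π is 2 - P + 3Q and its complex curvature operator is K(Q - P), where P and Q are
the orthogonal projections onto π and J₁π. Both planes are K-invariant, so both operators commute
with K. As Θ is a combination of 1 and K, it commutes with them too and maps π to itself; this gives
the two intertwining properties.

Θ does not preserve R because it does not commute with `J₁`: the plane of x and J₁x has sectional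
curvature 4, whereas its image under Θ is totally real and has sectional curvature 1
(`sectional_eq`, `sectional_twisted`).

To obtain K globally, remove the hyperplane: the affine chart trivializes the tangent bundle, and a
smooth complex linear square root h of the metric (`inner_metricRoot`) carries it to the flat
Hermitian space ℂ²ⁿ. The standard quaternionic j on ℂ²ⁿ then gives K = h⁻¹jh.

The Levi-Civita property and the curvature formula are checked in the single affine chart from
explicit Christoffel symbols (`fderiv_fubiniStudyForm`, `christoffel_curvature`). -/

/-! ### Calculus on the manifold read in the global affine chart. -/

/-- A vector field on the affine part of projective space, read in the affine coordinates. -/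
def rep {k : ℕ} (Y : ∀ p : AffineCP k, Tan p) (z : Cplx k) : Cplx k :=
  tangentEquiv (affinePoint k z) (Y (affinePoint k z))

lemma rep_affineCoord {k : ℕ} (Y : ∀ p : AffineCP k, Tan p) (p : AffineCP k) :
    rep Y (affineCoord k p.1) = tangentEquiv p (Y p) := by
  unfold rep
  rw [affinePoint_affineCoord]

lemma extChartAt_eq {k : ℕ} (p : AffineCP k) :
    extChartAt 𝓘(ℝ, Cplx k) p = (affineHomeomorph k).toEquiv.toPartialEquiv := by
  have : chartAt (Cplx k) p = (affineHomeomorph k).toOpenPartialHomeomorph := rfl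
  rw [extChartAt, this]
  ext <;> simp

lemma extChartAt_coe {k : ℕ} (p q : AffineCP k) :
    extChartAt 𝓘(ℝ, Cplx k) p q = affineCoord k q.1 := by
  rw [extChartAt_eq]; rfl

lemma extChartAt_symm_coe {k : ℕ} (p : AffineCP k) (z : Cplx k) :
    (extChartAt 𝓘(ℝ, Cplx k) p).symm z = affinePoint k z := by
  rw [extChartAt_eq]; rfl

lemma mfderiv_extChartAt {k : ℕ} (p q : AffineCP k) :
    mfderiv 𝓘(ℝ, Cplx k) 𝓘(ℝ, Cplx k) (extChartAt 𝓘(ℝ, Cplx k) p) q =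
      (tangentEquiv q : Tan q →L[ℝ] Cplx k) := by
  rw [← continuousLinearMapAt_eq p q]
  exact (TangentBundle.continuousLinearMapAt_trivializationAt (Set.mem_univ q)).symm

lemma trivializationAt_snd {k : ℕ} (p q : AffineCP k) (v : Tan q) :
    (trivializationAt (Cplx k) (TangentSpace 𝓘(ℝ, Cplx k)) p ⟨q, v⟩).2 = tangentEquiv q v := by
  have := congrArg (fun f => f v) (continuousLinearMapAt_eq p q)
  rw [← ContinuousLinearEquiv.coe_coe, ← this,
    Trivialization.continuousLinearMapAt_apply,
    Trivialization.coe_linearMapAt_of_mem _ (Set.mem_univ q)]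

lemma mdifferentiableAt_comp_affinePoint {k : ℕ} {F : Type*} [NormedAddCommGroup F]
    [NormedSpace ℝ F] (f : AffineCP k → F) (p : AffineCP k) :
    MDifferentiableAt 𝓘(ℝ, Cplx k) 𝓘(ℝ, F) f p ↔
      DifferentiableAt ℝ (fun z ↦ f (affinePoint k z)) (affineCoord k p.1) := by
  rw [mdifferentiableAt_iff]
  simp only [writtenInExtChartAt, extChartAt_coe, extChartAt_model_space_eq_id,
    modelWithCornersSelf_coe, Set.range_id, differentiableWithinAt_univ]
  have : ((PartialEquiv.refl F : F → F) ∘ f ∘ (extChartAt 𝓘(ℝ, Cplx k) p).symm) =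
      fun z ↦ f (affinePoint k z) := by
    ext z; exact congrArg f (extChartAt_symm_coe p z)
  rw [this, and_iff_right_iff_imp]
  intro h
  -- Continuity at `p` comes for free: `f` factors through the chart homeomorphism.
  have h1 : f = (fun z ↦ f (affinePoint k z)) ∘ (affineHomeomorph k) := by
    ext q
    exact congrArg f (affinePoint_affineCoord k q).symm
  rw [h1]
  exact ContinuousAt.comp (g := fun z ↦ f (affinePoint k z)) h.continuousAt
    (affineHomeomorph k).continuous.continuousAt

lemma mvfderiv_apply_eq_fderiv {k : ℕ} {F : Type*} [NormedAddCommGroup F]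
    [NormedSpace ℝ F] {f : AffineCP k → F} {p : AffineCP k}
    (hf : MDifferentiableAt 𝓘(ℝ, Cplx k) 𝓘(ℝ, F) f p) (v : Tan p) :
    mvfderiv 𝓘(ℝ, Cplx k) f p v =
      fderiv ℝ (fun z ↦ f (affinePoint k z)) (affineCoord k p.1) (tangentEquiv p v) := by
  have : mfderiv 𝓘(ℝ, Cplx k) 𝓘(ℝ, F) f p =
      fderiv ℝ (fun z ↦ f (affinePoint k z)) (affineCoord k p.1) := by
    rw [hf.mfderiv]
    simp only [extChartAt_coe, modelWithCornersSelf_coe, Set.range_id, fderivWithin_univ]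
    congr 1
  rw [mvfderiv, this]
  rfl

lemma mdifferentiableAt_iff_rep {k : ℕ} (Y : ∀ p : AffineCP k, TangentSpace 𝓘(ℝ, Cplx k) p) (p : AffineCP k) :
    MDifferentiableAt 𝓘(ℝ, Cplx k) (𝓘(ℝ, Cplx k).prod 𝓘(ℝ, Cplx k))
      (fun p ↦ TotalSpace.mk' (Cplx k) (E := fun p : AffineCP k ↦ TangentSpace 𝓘(ℝ, Cplx k) p)
        p (Y p)) p ↔ DifferentiableAt ℝ (rep Y) (affineCoord k p.1) := by
  rw [mdifferentiableAt_section]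
  simp only [trivializationAt_snd]
  exact mdifferentiableAt_comp_affinePoint _ p

/-- The chart trivializes the tangent bundle with identity transition maps, so the extensions used
to define `curvature` are constant fields in coordinates. -/
lemma rep_extend {k : ℕ} {p : AffineCP k} (v : Tan p) :
    rep (FiberBundle.extend (Cplx k) v) = fun _ ↦ tangentEquiv p v := by
  ext1 z
  unfold rep FiberBundle.extend
  simp only [trivializationAt_snd]
  have := congrArg (fun f => f (tangentEquiv p v)) (symmL_eq p (affinePoint k z))
  rw [Trivialization.symmL_apply _ (Set.mem_univ _)] at this
  rw [this]
  simp

lemma mfderivWithin_extChartAt_symm {k : ℕ} (p : AffineCP k) (z : Cplx k) :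
    (mfderivWithin 𝓘(ℝ, Cplx k) 𝓘(ℝ, Cplx k) (extChartAt 𝓘(ℝ, Cplx k) p).symm
      (Set.range 𝓘(ℝ, Cplx k)) z : Cplx k →L[ℝ] Cplx k) = ContinuousLinearMap.id ℝ (Cplx k) := by
  have h (q : AffineCP k) : (mfderivWithin 𝓘(ℝ, Cplx k) 𝓘(ℝ, Cplx k)
      (extChartAt 𝓘(ℝ, Cplx k) p).symm (Set.range 𝓘(ℝ, Cplx k)) (affineCoord k q.1) :
      Cplx k →L[ℝ] Cplx k) = ContinuousLinearMap.id ℝ (Cplx k) :=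
    (TangentBundle.symmL_trivializationAt (I := 𝓘(ℝ, Cplx k)) (x₀ := p) (x := q)
      (Set.mem_univ q)).symm.trans (symmL_eq p q)
  obtain ⟨q, rfl⟩ : ∃ q : AffineCP k, affineCoord k q.1 = z := ⟨_, affineCoord_affinePoint k z⟩
  exact h q

lemma mpullbackWithin_extChartAt_symm {k : ℕ} (p : AffineCP k) (X : ∀ p : AffineCP k, Tan p) :
    VectorField.mpullbackWithin 𝓘(ℝ, Cplx k) 𝓘(ℝ, Cplx k)
      (extChartAt 𝓘(ℝ, Cplx k) p).symm X (Set.range 𝓘(ℝ, Cplx k)) = rep X := by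
  ext1 z
  rw [VectorField.mpullbackWithin_apply]
  have h := (congrArg ContinuousLinearMap.inverse (mfderivWithin_extChartAt_symm p z)).trans
    ContinuousLinearMap.inverse_id
  exact congrArg (fun f : Cplx k →L[ℝ] Cplx k ↦ f (X (affinePoint k z))) h

lemma mlieBracket_eq_lieBracket {k : ℕ} (X Y : ∀ p : AffineCP k, Tan p) (p : AffineCP k) :
    tangentEquiv p (VectorField.mlieBracket 𝓘(ℝ, Cplx k) X Y p) =
      VectorField.lieBracket ℝ (rep X) (rep Y) (affineCoord k p.1) := by
  have h : (mfderiv 𝓘(ℝ, Cplx k) 𝓘(ℝ, Cplx k) (extChartAt 𝓘(ℝ, Cplx k) p) p :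
      Cplx k →L[ℝ] Cplx k).inverse = ContinuousLinearMap.id ℝ (Cplx k) :=
    (congrArg ContinuousLinearMap.inverse (mfderiv_extChartAt p p)).trans
      ContinuousLinearMap.inverse_id
  rw [VectorField.mlieBracket, VectorField.mlieBracketWithin_apply,
    mpullbackWithin_extChartAt_symm, mpullbackWithin_extChartAt_symm, extChartAt_coe]
  refine (congrArg (fun f : Cplx k →L[ℝ] Cplx k ↦ f _) h).trans ?_
  simp [VectorField.lieBracketWithin_univ]

/-! ### Christoffel symbols and the Levi-Civita connection. -/

/-- The Christoffel form of the Fubini–Study metric in the affine coordinates,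
`Γ_z(v, u) = -(⟨z, u⟩ v + ⟨z, v⟩ u) / (1 + |z|²)`. -/
def christoffel {k : ℕ} (z : Cplx k) : Cplx k →L[ℝ] Cplx k →L[ℝ] Cplx k :=
  (LinearMap.mk₂ ℝ (fun v u : Cplx k ↦
    -((1 + inner ℂ z z)⁻¹ : ℂ) • ((inner ℂ z u : ℂ) • v + (inner ℂ z v : ℂ) • u))
    (by intro v v' u; simp only [inner_add_right]; module)
    (by intro c v u; simp only [← Complex.coe_smul, inner_smul_right]; module)
    (by intro v u u'; simp only [inner_add_right]; module)
    (by intro c v u; simp only [← Complex.coe_smul, inner_smul_right]; module)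
    ).toContinuousBilinearMap

lemma christoffel_apply {k : ℕ} (z v u : Cplx k) :
    christoffel z v u =
      -((1 + inner ℂ z z)⁻¹ : ℂ) • ((inner ℂ z u : ℂ) • v + (inner ℂ z v : ℂ) • u) := rfl

lemma christoffel_symm {k : ℕ} (z v u : Cplx k) : christoffel z v u = christoffel z u v := by
  simp only [christoffel_apply]; module

lemma one_add_inner_self_ne_zero {k : ℕ} (z : Cplx k) : (1 + inner ℂ z z : ℂ) ≠ 0 := by
  rw [inner_self_eq_norm_sq_to_K]
  intro h
  have : ((1 + ‖z‖ ^ 2 : ℝ) : ℂ) = 0 := by rw [← h]; push_cast; rfl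
  rw [Complex.ofReal_eq_zero] at this
  exact (by positivity : (1 + ‖z‖ ^ 2 : ℝ) ≠ 0) this

lemma fubiniStudyForm_eq {k : ℕ} (z u w : Cplx k) :
    fubiniStudyForm z u w =
      (((1 + inner ℂ z z) * inner ℂ u w - inner ℂ u z * inner ℂ z w) /
        (1 + inner ℂ z z) ^ 2 : ℂ).re := by
  rw [fubiniStudyForm_apply, inner_self_eq_norm_sq_to_K]; rfl

/-- The Levi-Civita connection of the Fubini–Study metric. -/
def fubiniStudyConnection (k : ℕ) : Connection 𝓘(ℝ, Cplx k) (AffineCP k) where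
  toFun Y p := ((tangentEquiv p).symm : Cplx k →L[ℝ] Tan p) ∘L
    (fderiv ℝ (rep Y) (affineCoord k p.1) +
      christoffel (affineCoord k p.1) (tangentEquiv p (Y p))) ∘L (tangentEquiv p : Tan p →L[ℝ] Cplx k)
  isCovariantDerivativeOnUniv :=
    { add := by
        intro Y Y' p hY hY' _
        have h := (mdifferentiableAt_iff_rep _ _).1 hY
        have h' := (mdifferentiableAt_iff_rep _ _).1 hY'
        ext1 v
        have h2 : rep (Y + Y') = rep Y + rep Y' := by
          ext1 z; exact map_add (tangentEquiv (affinePoint k z)) _ _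
        rw [h2, fderiv_add h h', Pi.add_apply]
        apply (tangentEquiv p).injective
        simp [map_add]
        abel
      leibniz := by
        intro Y f p hY hf _
        have h := (mdifferentiableAt_iff_rep _ _).1 hY
        have h' := (mdifferentiableAt_comp_affinePoint _ _).1 hf
        ext1 v
        have h2 : rep (f • Y) = (fun z ↦ f (affinePoint k z)) • rep Y := by
          ext1 z; exact map_smul (tangentEquiv (affinePoint k z)) _ _
        rw [h2, fderiv_smul h' h]
        apply (tangentEquiv p).injective
        simp [map_add, mvfderiv_apply_eq_fderiv hf, rep_affineCoord, affinePoint_affineCoord]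
        abel }

lemma fubiniStudyConnection_apply {k : ℕ} (Y : ∀ p : AffineCP k, Tan p) (p : AffineCP k)
    (v : Tan p) : tangentEquiv p (fubiniStudyConnection k Y p v) =
      fderiv ℝ (rep Y) (affineCoord k p.1) (tangentEquiv p v) +
        christoffel (affineCoord k p.1) (tangentEquiv p (Y p)) (tangentEquiv p v) := rfl

/-- The derivative of the Fubini–Study metric in the affine coordinates. -/
lemma fderiv_fubiniStudyForm {k : ℕ} {Y Z : Cplx k → Cplx k} {z : Cplx k}
    (hY : DifferentiableAt ℝ Y z) (hZ : DifferentiableAt ℝ Z z) (v : Cplx k) :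
    fderiv ℝ (fun z ↦ fubiniStudyForm z (Y z) (Z z)) z v =
      fubiniStudyForm z (fderiv ℝ Y z v + christoffel z (Y z) v) (Z z) +
        fubiniStudyForm z (Y z) (fderiv ℝ Z z v + christoffel z (Z z) v) := by
  have hd : DifferentiableAt ℝ (fun z ↦ fubiniStudyForm z (Y z) (Z z)) z :=
    (((contDiff_fubiniStudyForm k).differentiable (by simp) z).clm_apply hY).clm_apply hZ
  -- Restricting to the line t ↦ z + tv reduces the claim to the one-variable product and quotient
  -- rules.
  have hl : HasDerivAt (fun t : ℝ ↦ z + t • v) v 0 := by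
    simpa using ((hasDerivAt_id (0 : ℝ)).smul_const v).const_add z
  have hl0 : z + (0 : ℝ) • v = z := by simp
  have comp {F : Type} [NormedAddCommGroup F] [NormedSpace ℝ F] {f : Cplx k → F}
      (hf : DifferentiableAt ℝ f z) : HasDerivAt (fun t : ℝ ↦ f (z + t • v)) (fderiv ℝ f z v) 0 := by
    have h := hf.hasFDerivAt
    rw [← hl0] at h
    exact h.comp_hasDerivAt (0 : ℝ) hl |>.congr_deriv (by rw [hl0])
  have h1 := comp hd
  have h2 : HasDerivAt (fun t : ℝ ↦ fubiniStudyForm (z + t • v) (Y (z + t • v)) (Z (z + t • v)))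
      (fubiniStudyForm z (fderiv ℝ Y z v + christoffel z (Y z) v) (Z z) +
        fubiniStudyForm z (Y z) (fderiv ℝ Z z v + christoffel z (Z z) v)) 0 := by
    simp only [fubiniStudyForm_eq]
    have hs := (hl.inner ℂ hl).const_add (1 : ℂ)
    have hn := (hs.mul ((comp hY).inner ℂ (comp hZ))).sub
      (((comp hY).inner ℂ hl).mul (hl.inner ℂ (comp hZ)))
    have hq := hn.fun_div (hs.pow 2) (by
      rw [Pi.pow_apply, hl0]; exact pow_ne_zero 2 (one_add_inner_self_ne_zero z))
    have hr := Complex.reCLM.hasFDerivAt.comp_hasDerivAt (0 : ℝ) hq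
    refine hr.congr_deriv ?_
    simp only [Pi.pow_apply, Pi.mul_apply, Pi.sub_apply, hl0, ← Complex.add_re,
      Complex.reCLM_apply]
    congr 1
    have hne := one_add_inner_self_ne_zero z
    have hc : (starRingEnd ℂ) (1 + inner ℂ z z : ℂ)⁻¹ = (1 + inner ℂ z z : ℂ)⁻¹ := by
      rw [map_inv₀, map_add, map_one, inner_conj_symm]
    simp only [christoffel_apply, inner_add_left, inner_add_right, inner_smul_left,
      inner_smul_right, inner_conj_symm, map_neg, hc]
    clear hr hq hn hs h1 comp hl0 hl hd hc
    -- From here on 1 + ⟨z, z⟩ enters only as a nonzero scalar, and the identity is one of rational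
    -- functions in it and the remaining inner products.
    generalize (1 + inner ℂ z z : ℂ) = S at hne ⊢
    simp only [Nat.cast_ofNat, Nat.add_one_sub_one, pow_one]
    field_simp
    ring
  exact h1.unique h2

/-- Torsion vanishes because the Christoffel form is symmetric, which leaves only the flat Lie
bracket; compatibility with the metric is `fderiv_fubiniStudyForm`. -/
theorem isLeviCivita_fubiniStudyConnection (k : ℕ) :
    IsLeviCivita (fubiniStudy k) (fubiniStudyConnection k) where
  torsion_free X Y p hX hY := by
    apply (tangentEquiv p).injective
    rw [map_sub, fubiniStudyConnection_apply, fubiniStudyConnection_apply,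
      mlieBracket_eq_lieBracket, VectorField.lieBracket, rep_affineCoord, rep_affineCoord,
      christoffel_symm]
    abel
  metric Y Z p v hY hZ := by
    have hY' := (mdifferentiableAt_iff_rep _ _).1 hY
    have hZ' := (mdifferentiableAt_iff_rep _ _).1 hZ
    have heq : (fun z ↦ (fubiniStudy k).inner (affinePoint k z) (Y (affinePoint k z))
        (Z (affinePoint k z))) = fun z ↦ fubiniStudyForm z (rep Y z) (rep Z z) := by
      ext1 z
      change fubiniStudyForm (affineCoord k (affinePoint k z).1) _ _ = _
      rw [affineCoord_affinePoint]
      rfl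
    have hd : MDifferentiableAt 𝓘(ℝ, Cplx k) 𝓘(ℝ, ℝ)
        (fun y ↦ (fubiniStudy k).inner y (Y y) (Z y)) p := by
      rw [mdifferentiableAt_comp_affinePoint, heq]
      exact (((contDiff_fubiniStudyForm k).differentiable (by simp) _).clm_apply hY').clm_apply hZ'
    rw [mvfderiv_apply_eq_fderiv hd, heq, fderiv_fubiniStudyForm hY' hZ']
    simp only [rep_affineCoord]
    rfl

/-! ### The curvature tensor of the Fubini–Study metric. -/

lemma fderiv_christoffel {k : ℕ} (z u v w : Cplx k) :
    fderiv ℝ (fun z ↦ christoffel z v w) z u =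
      ((1 + inner ℂ z z : ℂ)⁻¹ ^ 2 * (inner ℂ z u + inner ℂ u z)) •
        ((inner ℂ z w : ℂ) • v + (inner ℂ z v : ℂ) • w) -
      (1 + inner ℂ z z : ℂ)⁻¹ • ((inner ℂ u w : ℂ) • v + (inner ℂ u v : ℂ) • w) := by
  have hi (a : Cplx k) : HasFDerivAt (𝕜 := ℝ) (fun z : Cplx k ↦ (inner ℂ z a : ℂ)) _ z :=
    (hasFDerivAt_id z).inner ℂ (hasFDerivAt_const a z)
  have hs : HasFDerivAt (𝕜 := ℝ) (fun z : Cplx k ↦ (1 + inner ℂ z z : ℂ)) _ z :=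
    ((hasFDerivAt_id z).inner ℂ (hasFDerivAt_id z)).const_add 1
  have hinv := (hasFDerivAt_inv (𝕜 := ℂ) (one_add_inner_self_ne_zero z)).restrictScalars ℝ |>.comp z hs
  have h := hinv.neg.fun_smul (((hi w).smul_const v).add ((hi v).smul_const w))
  simp only [christoffel_apply]
  have h2 := h.fderiv
  simp only [Function.comp_def] at h2
  erw [h2]
  simp
  module

/-- The Hermitian form whose real part is the Fubini–Study inner product. -/
def fubiniStudyHermitian {k : ℕ} (z u w : Cplx k) : ℂ :=
  ((1 + inner ℂ z z) * inner ℂ u w - inner ℂ u z * inner ℂ z w) / (1 + inner ℂ z z) ^ 2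

lemma fubiniStudyForm_eq_re {k : ℕ} (z u w : Cplx k) :
    fubiniStudyForm z u w = (fubiniStudyHermitian z u w).re := fubiniStudyForm_eq z u w

lemma fubiniStudyHermitian_I_smul_left {k : ℕ} (z u w : Cplx k) :
    fubiniStudyHermitian z (Complex.I • u) w = -Complex.I * fubiniStudyHermitian z u w := by
  simp only [fubiniStudyHermitian, inner_smul_left, Complex.conj_I]
  ring

lemma fubiniStudyHermitian_I_smul_right {k : ℕ} (z u w : Cplx k) :
    fubiniStudyHermitian z u (Complex.I • w) = Complex.I * fubiniStudyHermitian z u w := by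
  simp only [fubiniStudyHermitian, inner_smul_right]
  ring

/-- With H the Hermitian form, H(iu, w) = -iH(u, w) has real part Im H(u, w), so the two real terms
reassemble Re H + i Im H. This and the next lemma translate the complex form of the curvature into
the real form with `standardJ`. -/
lemma fubiniStudyForm_smul_add {k : ℕ} (z u w v : Cplx k) :
    fubiniStudyForm z u w • v + fubiniStudyForm z (Complex.I • u) w • Complex.I • v =
      fubiniStudyHermitian z u w • v := by
  have h : (fubiniStudyForm z (Complex.I • u) w : ℂ) = (fubiniStudyHermitian z u w).im := by
    rw [fubiniStudyForm_eq_re, fubiniStudyHermitian_I_smul_left]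
    simp
  rw [← Complex.coe_smul, ← Complex.coe_smul, h, fubiniStudyForm_eq_re, smul_smul, ← add_smul, Complex.re_add_im]

lemma two_mul_fubiniStudyForm_smul {k : ℕ} (z u w v : Cplx k) :
    (2 * fubiniStudyForm z (Complex.I • u) w) • Complex.I • v =
      (fubiniStudyHermitian z u w - fubiniStudyHermitian z w u) • v := by
  have h1 := fubiniStudyForm_smul_add z u w v
  have h2 := fubiniStudyForm_smul_add z w u v
  have h3 : fubiniStudyForm z (Complex.I • w) u = -fubiniStudyForm z (Complex.I • u) w := by
    rw [fubiniStudyForm_symm, fubiniStudyForm_eq_re, fubiniStudyForm_eq_re,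
      fubiniStudyHermitian_I_smul_left, fubiniStudyHermitian_I_smul_right]
    simp
  rw [fubiniStudyForm_symm z w u, h3] at h2
  rw [sub_smul, ← h1, ← h2]
  module

/-- This is the coordinate expression dΓ + Γ ∧ Γ of the curvature on constant fields; the symmetric
terms cancel on exchanging `x` and `y`. -/
lemma christoffel_curvature {k : ℕ} (z x y w : Cplx k) :
    fderiv ℝ (fun z ↦ christoffel z w y) z x + christoffel z (christoffel z w y) x -
      (fderiv ℝ (fun z ↦ christoffel z w x) z y + christoffel z (christoffel z w x) y) =
    fubiniStudyHermitian z y w • x - fubiniStudyHermitian z x w • y -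
      (fubiniStudyHermitian z x y - fubiniStudyHermitian z y x) • w := by
  have hne := one_add_inner_self_ne_zero z
  rw [fderiv_christoffel, fderiv_christoffel, christoffel_apply, christoffel_apply,
    christoffel_apply, christoffel_apply]
  simp only [fubiniStudyHermitian, inner_add_right, inner_smul_right]
  generalize (1 + inner ℂ z z : ℂ) = S at hne ⊢
  match_scalars <;> field_simp <;> ring

/-- The curvature of the Fubini–Study metric: constant holomorphic sectional curvature `4`. -/
theorem curvature_fubiniStudyConnection {k : ℕ} (p : AffineCP k) (x y w : Tan p) :
    curvature (fubiniStudyConnection k) x y w =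
      (fubiniStudy k).inner p y w • x - (fubiniStudy k).inner p x w • y
        + (fubiniStudy k).inner p (standardJ k p y) w • standardJ k p x
        - (fubiniStudy k).inner p (standardJ k p x) w • standardJ k p y
        - (2 * (fubiniStudy k).inner p (standardJ k p x) y) • standardJ k p w := by
  have hcov (a b : Tan p) : rep (fun q ↦ fubiniStudyConnection k (FiberBundle.extend (Cplx k) a) q
      (FiberBundle.extend (Cplx k) b q)) =
        fun z ↦ christoffel z (tangentEquiv p a) (tangentEquiv p b) := by
    ext1 z
    rw [rep, fubiniStudyConnection_apply, rep_extend, fderiv_const_apply, affineCoord_affinePoint]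
    change 0 + christoffel z (rep (FiberBundle.extend (Cplx k) a) z)
      (rep (FiberBundle.extend (Cplx k) b) z) = _
    rw [rep_extend, rep_extend, zero_add]
  have hval (a b : Tan p) : tangentEquiv p (fubiniStudyConnection k
      (FiberBundle.extend (Cplx k) a) p (FiberBundle.extend (Cplx k) b p)) =
        christoffel (affineCoord k p.1) (tangentEquiv p a) (tangentEquiv p b) := by
    rw [← congrFun (hcov a b), rep_affineCoord]
  -- Fields constant in the chart commute, so the bracket term of the curvature drops out.
  have hlie : VectorField.mlieBracket 𝓘(ℝ, Cplx k) (FiberBundle.extend (Cplx k) x)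
      (FiberBundle.extend (Cplx k) y) p = 0 := by
    apply (tangentEquiv p).injective
    rw [mlieBracket_eq_lieBracket, rep_extend, rep_extend, VectorField.lieBracket]
    simp
  apply (tangentEquiv p).injective
  rw [curvature, curvatureOfFields, hlie, map_zero, sub_zero, map_sub,
    fubiniStudyConnection_apply, hcov, hval, fubiniStudyConnection_apply, hcov, hval,
    FiberBundle.extend_apply_self, FiberBundle.extend_apply_self, christoffel_curvature,
    ← two_mul_fubiniStudyForm_smul, ← fubiniStudyForm_smul_add, ← fubiniStudyForm_smul_add]
  simp only [map_sub, map_add, map_smul]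
  have key (a b c d e : Cplx k) : a + b - (c + d) - e = a - c + b - d - e := by abel
  exact key _ _ _ _ _

/-! ### The quaternion structure -/

/-- The standard quaternionic structure `j` on `ℂ²ⁿ`: it is conjugate linear and pairs the
coordinates `i` and `2 n - 1 - i`. -/
def quatJ (n : ℕ) : Cplx (2 * n) →L[ℝ] Cplx (2 * n) :=
  LinearMap.toContinuousLinearMap
    { toFun := fun v ↦ WithLp.toLp 2 fun i ↦
        (if (i : ℕ) < n then 1 else -1 : ℂ) * starRingEnd ℂ (v i.rev)
      map_add' := by intro v w; ext i; simp [mul_add]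
      map_smul' := by intro c v; ext i; simp }

lemma quatJ_apply {n : ℕ} (v : Cplx (2 * n)) (i : Fin (2 * n)) :
    quatJ n v i = (if (i : ℕ) < n then 1 else -1 : ℂ) * starRingEnd ℂ (v i.rev) := rfl

/-- Reversal exchanges the two halves of the index set, so the signs at i and at its mirror image
multiply to -1. -/
lemma quatJ_quatJ {n : ℕ} (v : Cplx (2 * n)) : quatJ n (quatJ n v) = -v := by
  ext i
  have hi := i.2
  simp only [quatJ_apply, Fin.rev_rev, map_mul, Complex.conj_conj, PiLp.neg_apply, Fin.val_rev]
  by_cases h : (i : ℕ) < n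
  · have h' : ¬ (2 * n - ((i : ℕ) + 1) < n) := by omega
    simp [h, h']
  · have h' : 2 * n - ((i : ℕ) + 1) < n := by omega
    simp [h, h']

lemma quatJ_smul {n : ℕ} (c : ℂ) (v : Cplx (2 * n)) :
    quatJ n (c • v) = starRingEnd ℂ c • quatJ n v := by
  ext i
  simp only [quatJ_apply, PiLp.smul_apply, smul_eq_mul, map_mul]
  ring

lemma inner_quatJ {n : ℕ} (v w : Cplx (2 * n)) :
    inner ℂ (quatJ n v) (quatJ n w) = starRingEnd ℂ (inner ℂ v w) := by
  rw [inner_conj_symm]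
  simp only [PiLp.inner_apply, quatJ_apply]
  refine Fintype.sum_equiv Fin.revPerm _ _ fun i ↦ ?_
  simp only [RCLike.inner_apply, map_mul, Complex.conj_conj, Fin.revPerm_apply]
  split_ifs <;> simp <;> ring

/-! ### A smooth square root of the metric. -/

/-- `√(1 + |z|²)`. -/
def radius {k : ℕ} (z : Cplx k) : ℝ := Real.sqrt (1 + ‖z‖ ^ 2)

lemma radius_pos {k : ℕ} (z : Cplx k) : 0 < radius z := Real.sqrt_pos.2 (by positivity)

lemma radius_sq {k : ℕ} (z : Cplx k) : (radius z : ℂ) ^ 2 = 1 + inner ℂ z z := by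
  rw [inner_self_eq_norm_sq_to_K, ← Complex.ofReal_pow, radius, Real.sq_sqrt (by positivity)]
  push_cast
  rfl

lemma contDiff_radius (k : ℕ) : ContDiff ℝ ∞ (radius : Cplx k → ℝ) :=
  (contDiff_const.add (contDiff_norm_sq ℝ)).sqrt fun z ↦ by positivity

lemma radius_ne_zero {k : ℕ} (z : Cplx k) : (radius z : ℂ) ≠ 0 :=
  Complex.ofReal_ne_zero.2 (radius_pos z).ne'

lemma radius_add_one_ne_zero {k : ℕ} (z : Cplx k) : (radius z + 1 : ℂ) ≠ 0 := by
  have := radius_pos z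
  exact_mod_cast (by positivity : (radius z + 1 : ℝ) ≠ 0)

/-- The rank one operator `u ↦ ⟨z, u⟩ z`. -/
def rankOne {k : ℕ} (z : Cplx k) : Cplx k →L[ℝ] Cplx k :=
  ((innerSL ℂ z).smulRight z).restrictScalars ℝ

lemma rankOne_apply {k : ℕ} (z u : Cplx k) : rankOne z u = (inner ℂ z u : ℂ) • z := rfl

lemma contDiff_rankOne (k : ℕ) : ContDiff ℝ ∞ (rankOne : Cplx k → _) := by
  rw [contDiff_clm_apply_iff]
  intro u
  simp only [rankOne_apply]
  exact (contDiff_id.inner ℂ contDiff_const).smul contDiff_id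

/-- The positive square root of the Fubini–Study metric with respect to the flat metric. -/
def metricRoot {k : ℕ} (z : Cplx k) : Cplx k →L[ℝ] Cplx k :=
  (radius z)⁻¹ • (ContinuousLinearMap.id ℝ _ - (radius z * (radius z + 1))⁻¹ • rankOne z)

/-- The inverse of `metricRoot`. -/
def metricRootInv {k : ℕ} (z : Cplx k) : Cplx k →L[ℝ] Cplx k :=
  radius z • (ContinuousLinearMap.id ℝ _ + (radius z + 1)⁻¹ • rankOne z)

lemma metricRoot_apply {k : ℕ} (z u : Cplx k) : metricRoot z u =
    (radius z : ℂ)⁻¹ • (u - ((radius z : ℂ) * (radius z + 1))⁻¹ • (inner ℂ z u : ℂ) • z) := by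
  simp only [metricRoot, ← Complex.ofReal_one, ← Complex.ofReal_add, ← Complex.ofReal_mul,
    ← Complex.ofReal_inv, Complex.coe_smul]
  rfl

lemma metricRootInv_apply {k : ℕ} (z u : Cplx k) : metricRootInv z u =
    (radius z : ℂ) • (u + (radius z + 1 : ℂ)⁻¹ • (inner ℂ z u : ℂ) • z) := by
  simp only [metricRootInv, ← Complex.ofReal_one, ← Complex.ofReal_add,
    ← Complex.ofReal_inv, Complex.coe_smul]
  rfl

lemma contDiff_metricRoot (k : ℕ) : ContDiff ℝ ∞ (metricRoot : Cplx k → _) := by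
  have h := contDiff_radius k
  refine (h.inv fun z ↦ (radius_pos z).ne').smul (contDiff_const.sub
    (((h.mul (h.add contDiff_const)).inv fun z ↦ ?_).smul (contDiff_rankOne k)))
  have := radius_pos z
  positivity

lemma contDiff_metricRootInv (k : ℕ) : ContDiff ℝ ∞ (metricRootInv : Cplx k → _) := by
  have h := contDiff_radius k
  refine h.smul (contDiff_const.add
    (((h.add contDiff_const).inv fun z ↦ ?_).smul (contDiff_rankOne k)))
  have := radius_pos z
  positivity

lemma metricRootInv_metricRoot {k : ℕ} (z u : Cplx k) : metricRootInv z (metricRoot z u) = u := by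
  have h1 := radius_ne_zero z
  have h2 := radius_add_one_ne_zero z
  have h3 : (inner ℂ z z : ℂ) = (radius z : ℂ) ^ 2 - 1 := by rw [radius_sq]; ring
  simp only [metricRoot_apply, metricRootInv_apply, inner_smul_right, inner_sub_right, h3]
  match_scalars
  · field_simp
  · field_simp
    ring

lemma metricRoot_metricRootInv {k : ℕ} (z u : Cplx k) : metricRoot z (metricRootInv z u) = u := by
  have h1 := radius_ne_zero z
  have h2 := radius_add_one_ne_zero z
  have h3 : (inner ℂ z z : ℂ) = (radius z : ℂ) ^ 2 - 1 := by rw [radius_sq]; ring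
  simp only [metricRoot_apply, metricRootInv_apply, inner_smul_right, inner_add_right, h3]
  match_scalars
  · field_simp
  · field_simp
    ring

lemma metricRoot_smul {k : ℕ} (z u : Cplx k) (c : ℂ) :
    metricRoot z (c • u) = c • metricRoot z u := by
  simp only [metricRoot_apply, inner_smul_right]
  module

lemma metricRootInv_smul {k : ℕ} (z u : Cplx k) (c : ℂ) :
    metricRootInv z (c • u) = c • metricRootInv z u := by
  simp only [metricRootInv_apply, inner_smul_right]
  module

/-- With r = `radius z`, the metric has eigenvalues r⁻² on the complement of z and r⁻⁴ along z,
while `metricRoot` has r⁻¹ and r⁻². Writing the correction as a multiple of ⟨z, ·⟩z with coefficient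
depending on r alone avoids dividing by |z|², so it is smooth at the origin. -/
lemma inner_metricRoot {k : ℕ} (z u w : Cplx k) :
    inner ℂ (metricRoot z u) (metricRoot z w) = fubiniStudyHermitian z u w := by
  have h1 := radius_ne_zero z
  have h2 := radius_add_one_ne_zero z
  have h3 : (inner ℂ z z : ℂ) = (radius z : ℂ) ^ 2 - 1 := by rw [radius_sq]; ring
  simp only [metricRoot_apply, fubiniStudyHermitian, inner_smul_right, inner_sub_right,
    inner_smul_left, inner_sub_left, h3, map_inv₀, map_mul, map_add, map_one, Complex.conj_ofReal,
    inner_conj_symm]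
  field_simp
  ring

/-! ### The structures J₂ and J₃ and the isometry field Θ. -/

/-- The second almost complex structure in the affine coordinates. -/
def secondJ {n : ℕ} (z : Cplx (2 * n)) : Cplx (2 * n) →L[ℝ] Cplx (2 * n) :=
  metricRootInv z ∘L quatJ n ∘L metricRoot z

lemma secondJ_apply {n : ℕ} (z u : Cplx (2 * n)) :
    secondJ z u = metricRootInv z (quatJ n (metricRoot z u)) := rfl

lemma contDiff_secondJ (n : ℕ) : ContDiff ℝ ∞ (secondJ : Cplx (2 * n) → _) :=
  (contDiff_metricRootInv _).clm_comp (contDiff_const.clm_comp (contDiff_metricRoot _))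

lemma secondJ_secondJ {n : ℕ} (z u : Cplx (2 * n)) : secondJ z (secondJ z u) = -u := by
  simp only [secondJ_apply, metricRoot_metricRootInv, quatJ_quatJ, map_neg,
    metricRootInv_metricRoot]

/-- Conjugating by the complex linear `metricRoot` keeps `quatJ` conjugate linear; this is the
anticommutation of J₁ and J₂. -/
lemma secondJ_I_smul {n : ℕ} (z u : Cplx (2 * n)) :
    secondJ z (Complex.I • u) = -(Complex.I • secondJ z u) := by
  simp only [secondJ_apply, metricRoot_smul, quatJ_smul, metricRootInv_smul, Complex.conj_I,
    neg_smul, map_neg]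

lemma fubiniStudyForm_secondJ {n : ℕ} (z u w : Cplx (2 * n)) :
    fubiniStudyForm z (secondJ z u) (secondJ z w) = fubiniStudyForm z u w := by
  simp only [fubiniStudyForm_eq_re, ← inner_metricRoot, secondJ_apply, metricRoot_metricRootInv,
    inner_quatJ, Complex.conj_re]

lemma contMDiff_comp_affineCoord {k : ℕ} {F : Type*} [NormedAddCommGroup F] [NormedSpace ℝ F]
    {f : Cplx k → F} (hf : ContDiff ℝ ∞ f) :
    ContMDiff 𝓘(ℝ, Cplx k) 𝓘(ℝ, F) ∞ (fun p : AffineCP k ↦ f (affineCoord k p.1)) :=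
  hf.contMDiff.comp (contMDiff_affineCoord k)

/-- The almost complex structure `J₂`. -/
def quaternionJ₂ (n : ℕ) : UnitaryAlmostComplexStructure (fubiniStudy (2 * n)) where
  toFun p := ((tangentEquiv p).symm : Cplx (2 * n) →L[ℝ] Tan p) ∘L secondJ (affineCoord _ p.1) ∘L
    (tangentEquiv p : Tan p →L[ℝ] Cplx (2 * n))
  smooth := smoothEndField_of_contMDiff _ (contMDiff_comp_affineCoord (contDiff_secondJ n))
  sq _ _ := secondJ_secondJ _ _
  isometry _ _ _ := fubiniStudyForm_secondJ _ _ _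

/-- The almost complex structure `J₃ = J₁ J₂`. -/
def quaternionJ₃ (n : ℕ) : UnitaryAlmostComplexStructure (fubiniStudy (2 * n)) where
  toFun p := ((tangentEquiv p).symm : Cplx (2 * n) →L[ℝ] Tan p) ∘L
    (mulI (2 * n) ∘L secondJ (affineCoord _ p.1)) ∘L
    (tangentEquiv p : Tan p →L[ℝ] Cplx (2 * n))
  smooth := smoothEndField_of_contMDiff _
    (contMDiff_comp_affineCoord (contDiff_const.clm_comp (contDiff_secondJ n)))
  sq p v := by
    change Complex.I • secondJ _ (Complex.I • secondJ _ (tangentEquiv p v)) = -tangentEquiv p v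
    rw [secondJ_I_smul, secondJ_secondJ, smul_neg, smul_neg, smul_neg, smul_smul, Complex.I_mul_I]
    simp
  isometry p v w := ((standardJ (2 * n)).isometry p _ _).trans ((quaternionJ₂ n).isometry p v w)

theorem isQuaternionStructure (n : ℕ) :
    IsQuaternionStructure (standardJ (2 * n)) (quaternionJ₂ n) (quaternionJ₃ n) :=
  fun _ _ ↦ ⟨rfl, secondJ_I_smul _ _⟩

/-- The isometry field `Θ = (1 + J₂) / √2`. -/
def quaternionTheta (n : ℕ) : ComplexIsometryField (quaternionJ₂ n) where
  -- The inverse is (1 - J₂)/√2, because (1 + J₂)(1 - J₂) = 1 - J₂² = 2.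
  toFun p := ContinuousLinearEquiv.equivOfInverse
    ((Real.sqrt 2)⁻¹ • (ContinuousLinearMap.id ℝ (Tan p) + quaternionJ₂ n p))
    ((Real.sqrt 2)⁻¹ • (ContinuousLinearMap.id ℝ (Tan p) - quaternionJ₂ n p))
    (fun v ↦ by
      simp only [_root_.smul_apply, _root_.add_apply,
        _root_.sub_apply, ContinuousLinearMap.id_apply, map_smul, map_add,
        (quaternionJ₂ n).sq]
      match_scalars <;> field_simp <;> norm_num)
    (fun v ↦ by
      simp only [_root_.smul_apply, _root_.add_apply,
        _root_.sub_apply, ContinuousLinearMap.id_apply, map_smul, map_sub,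
        (quaternionJ₂ n).sq]
      match_scalars <;> field_simp <;> norm_num)
  smooth := smoothEndField_of_contMDiff
    (fun p : AffineCP (2 * n) ↦ (Real.sqrt 2)⁻¹ • (ContinuousLinearMap.id ℝ (Cplx (2 * n)) +
      secondJ (affineCoord _ p.1)))
    (contMDiff_comp_affineCoord
      (f := fun z ↦ (Real.sqrt 2)⁻¹ • (ContinuousLinearMap.id ℝ (Cplx (2 * n)) + secondJ z))
      (ContDiff.smul (f := fun _ ↦ (Real.sqrt 2)⁻¹)
        (g := fun z ↦ ContinuousLinearMap.id ℝ (Cplx (2 * n)) + secondJ z)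
        contDiff_const (contDiff_const.add (contDiff_secondJ n))))
  isometry p v w := by
    have h1 := (quaternionJ₂ n).isometry p v w
    -- Skew-adjointness of J₂ makes the two cross terms cancel.
    have h2 := (quaternionJ₂ n).isometry p v (quaternionJ₂ n p w)
    rw [(quaternionJ₂ n).sq, map_neg] at h2
    have h3 : (Real.sqrt 2)⁻¹ * (Real.sqrt 2)⁻¹ = (1 / 2 : ℝ) := by
      rw [← mul_inv, Real.mul_self_sqrt (by norm_num)]; norm_num
    simp only [ContinuousLinearEquiv.equivOfInverse_apply, _root_.smul_apply,
      _root_.add_apply, ContinuousLinearMap.id_apply, map_smul, map_add, smul_eq_mul]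
    rw [h1, ← h2]
    linear_combination (2 * (fubiniStudy (2 * n)).inner p v w) * h3
  commutes p v := by
    simp only [ContinuousLinearEquiv.equivOfInverse_apply, _root_.smul_apply,
      _root_.add_apply, ContinuousLinearMap.id_apply, map_smul, map_add]

/-! ### Algebra of the curvature tensor -/

section Algebra

variable {V : Type*} [AddCommGroup V] [Module ℝ V]

/-- The curvature tensor of constant holomorphic sectional curvature `4` with respect to the
inner product `g` and the complex structure `J`. -/
def holomorphicCurvature (g : V → V → ℝ) (J : V → V) (x y w : V) : V :=
  g y w • x - g x w • y + g (J y) w • J x - g (J x) w • J y - (2 * g (J x) y) • J w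

/-- A real inner product together with two anticommuting orthogonal complex structures. -/
structure QuaternionicData (g : V → V → ℝ) (J K : V → V) : Prop where
  add_left : ∀ x y w, g (x + y) w = g x w + g y w
  smul_left : ∀ (c : ℝ) x w, g (c • x) w = c * g x w
  symm : ∀ x y, g x y = g y x
  map_add₁ : ∀ x y, J (x + y) = J x + J y
  map_smul₁ : ∀ (c : ℝ) x, J (c • x) = c • J x
  map_add₂ : ∀ x y, K (x + y) = K x + K y
  map_smul₂ : ∀ (c : ℝ) x, K (c • x) = c • K x
  sq₁ : ∀ x, J (J x) = -x
  sq₂ : ∀ x, K (K x) = -x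
  isometry₁ : ∀ x y, g (J x) (J y) = g x y
  isometry₂ : ∀ x y, g (K x) (K y) = g x y
  anticomm : ∀ x, K (J x) = -J (K x)

namespace QuaternionicData

variable {g : V → V → ℝ} {J K : V → V} (h : QuaternionicData g J K)
include h

lemma add_right (x y w : V) : g x (y + w) = g x y + g x w := by
  rw [h.symm, h.add_left, h.symm y, h.symm w]

lemma smul_right (c : ℝ) (x w : V) : g x (c • w) = c * g x w := by
  rw [h.symm, h.smul_left, h.symm]

lemma neg_left (x w : V) : g (-x) w = -g x w := by
  rw [← neg_one_smul ℝ, h.smul_left]; ring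

lemma neg_right (x w : V) : g x (-w) = -g x w := by
  rw [h.symm, h.neg_left, h.symm]

lemma map_neg₁ (x : V) : J (-x) = -J x := by
  rw [← neg_one_smul ℝ, h.map_smul₁, neg_one_smul]

lemma map_neg₂ (x : V) : K (-x) = -K x := by
  rw [← neg_one_smul ℝ, h.map_smul₂, neg_one_smul]

lemma skew₁ (x y : V) : g (J x) y = -g x (J y) := by
  rw [← h.isometry₁ x (J y), h.sq₁, h.neg_right, neg_neg]

lemma skew₂ (x y : V) : g (K x) y = -g x (K y) := by
  rw [← h.isometry₂ x (K y), h.sq₂, h.neg_right, neg_neg]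

lemma self₁ (x : V) : g x (J x) = 0 := by
  have := h.skew₁ x x
  rw [h.symm] at this
  linarith

lemma self₂ (x : V) : g x (K x) = 0 := by
  have := h.skew₂ x x
  rw [h.symm] at this
  linarith

/-- The product of two anticommuting skew operators is again skew. -/
lemma self₃ (x : V) : g x (J (K x)) = 0 := by
  have h1 := h.skew₁ x (K x)
  have h2 := h.skew₂ x (J x)
  rw [h.anticomm, h.neg_right, neg_neg, h.symm, h1] at h2
  linarith

/-- This is the form 2 - P + 3Q, with P and Q the projections onto the planes of x, Kx and of Jx,
JKx. Rotation invariance and commutation with K are read off from it. -/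
lemma complexJacobi_eq {x : V} (hx : g x x = 1) (y : V) :
    holomorphicCurvature g J y x x + holomorphicCurvature g J y (K x) (K x) =
      (2 : ℝ) • y - g y x • x - g y (K x) • K x + (3 * g y (J x)) • J x +
        (3 * g y (J (K x))) • J (K x) := by
  have h1 : g (K x) (K x) = 1 := by rw [h.isometry₂, hx]
  simp only [holomorphicCurvature, hx, h1, h.skew₁ y, h.symm (J x) x, h.symm (J (K x)) (K x), h.self₁]
  module

/-- The term in J y drops out because Jx is orthogonal to Kx; for unit x the rest is K(Q - P). -/
lemma complexCurvature_eq (x y : V) :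
    holomorphicCurvature g J x (K x) y =
      g y (K x) • x - g y x • K x + g y (J (K x)) • J x - g y (J x) • J (K x) := by
  have h1 : g (J x) (K x) = 0 := by rw [h.skew₁, h.self₃, neg_zero]
  simp only [holomorphicCurvature, h1, h.symm _ y]
  module

/-- The complex Jacobi operator depends only on the complex line. -/
lemma complexJacobi_rotate {x : V} {a b : ℝ} (hab : a ^ 2 + b ^ 2 = 1) (y : V) :
    (2 : ℝ) • y - g y (a • x + b • K x) • (a • x + b • K x)
        - g y (K (a • x + b • K x)) • K (a • x + b • K x)
        + (3 * g y (J (a • x + b • K x))) • J (a • x + b • K x)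
        + (3 * g y (J (K (a • x + b • K x)))) • J (K (a • x + b • K x)) =
      (2 : ℝ) • y - g y x • x - g y (K x) • K x + (3 * g y (J x)) • J x +
        (3 * g y (J (K x))) • J (K x) := by
  simp only [h.map_add₁, h.map_add₂, h.map_smul₁, h.map_smul₂, h.sq₂, h.map_neg₁, h.add_right,
    h.smul_right, h.neg_right]
  match_scalars
  · ring
  · linear_combination (-g y x) * hab
  · linear_combination (-g y (K x)) * hab
  · linear_combination (3 * g y (J x)) * hab
  · linear_combination (3 * g y (J (K x))) * hab

lemma complexCurvature_rotate {x : V} {a b : ℝ} (hab : a ^ 2 + b ^ 2 = 1) (y : V) :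
    holomorphicCurvature g J (a • x + b • K x) (K (a • x + b • K x)) y =
      holomorphicCurvature g J x (K x) y := by
  simp only [h.complexCurvature_eq]
  simp only [h.map_add₁, h.map_add₂, h.map_smul₁, h.map_smul₂, h.sq₂, h.map_neg₁, h.add_right,
    h.smul_right, h.neg_right]
  match_scalars
  · linear_combination (g y (K x)) * hab
  · linear_combination (-g y x) * hab
  · linear_combination (g y (J (K x))) * hab
  · linear_combination (-g y (J x)) * hab

lemma complexJacobi_commutes {x : V} (hx : g x x = 1) (y : V) :
    K (holomorphicCurvature g J y x x + holomorphicCurvature g J y (K x) (K x)) =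
      holomorphicCurvature g J (K y) x x + holomorphicCurvature g J (K y) (K x) (K x) := by
  simp only [h.complexJacobi_eq hx, sub_eq_add_neg, h.map_add₂, h.map_neg₂, h.map_smul₂,
    h.anticomm, h.sq₂, h.skew₂ y, h.map_neg₁, h.neg_right]
  module

lemma complexCurvature_commutes (x y : V) :
    K (holomorphicCurvature g J x (K x) y) = holomorphicCurvature g J x (K x) (K y) := by
  simp only [h.complexCurvature_eq, sub_eq_add_neg, h.map_add₂, h.map_neg₂, h.map_smul₂,
    h.anticomm, h.sq₂, h.skew₂ y, h.map_neg₁, h.neg_right]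
  module

lemma holomorphicCurvature_add (x y w w' : V) : holomorphicCurvature g J x y (w + w') =
    holomorphicCurvature g J x y w + holomorphicCurvature g J x y w' := by
  simp only [holomorphicCurvature, h.add_right, h.map_add₁]
  module

lemma holomorphicCurvature_add_left (x y y' w : V) : holomorphicCurvature g J (y + y') x w =
    holomorphicCurvature g J y x w + holomorphicCurvature g J y' x w := by
  simp only [holomorphicCurvature, h.add_left, h.map_add₁]
  module

lemma holomorphicCurvature_smul (c : ℝ) (x y w : V) : holomorphicCurvature g J x y (c • w) =
    c • holomorphicCurvature g J x y w := by
  simp only [holomorphicCurvature, h.smul_right, h.map_smul₁]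
  module

lemma holomorphicCurvature_smul_left (c : ℝ) (x y w : V) : holomorphicCurvature g J (c • y) x w =
    c • holomorphicCurvature g J y x w := by
  simp only [holomorphicCurvature, h.smul_left, h.map_smul₁]
  module

lemma sectional_eq (x : V) :
    g (holomorphicCurvature g J x (J x) (J x)) x = 4 * g x x ^ 2 := by
  simp only [holomorphicCurvature, sub_eq_add_neg, h.add_left, h.neg_left, h.smul_left, h.sq₁,
    h.isometry₁, h.symm (J x) x, h.self₁]
  ring

/-- With c = ±1/√2, the two arguments are the images of x and Jx under c(1 + K). The second is c(Jx
- JKx), orthogonal to J of the first, c(Jx + JKx), so the plane is totally real and only the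
constant curvature 1 part of the tensor contributes. -/
lemma sectional_twisted (x : V) {c : ℝ} (hc : c ^ 2 = 1 / 2) :
    g (holomorphicCurvature g J (c • (x + K x)) (c • (J x + K (J x))) (c • (J x + K (J x))))
      (c • (x + K x)) = g x x ^ 2 := by
  have e1 : g (K x) x = 0 := by rw [h.symm, h.self₂]
  have e2 : g (J x) x = 0 := by rw [h.symm, h.self₁]
  have e3 : g (J (K x)) x = 0 := by rw [h.symm, h.self₃]
  have e4 : g (J x) (K x) = 0 := by rw [h.skew₁, h.self₃, neg_zero]
  have e4' : g (K x) (J x) = 0 := by rw [h.symm, e4]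
  have e5 : g (J (K x)) (K x) = 0 := by rw [h.symm, h.self₁]
  simp only [holomorphicCurvature, sub_eq_add_neg, h.add_left, h.add_right, h.neg_left,
    h.neg_right, h.smul_left, h.smul_right, h.sq₁, h.map_smul₁, h.map_add₁, h.map_neg₁,
    h.isometry₁, h.isometry₂, h.anticomm, h.self₁, h.self₂, h.self₃, e1, e2, e3, e4, e4', e5]
  -- The left side is 4c⁴g(x, x)², and c⁴ - 1/4 = (c² - 1/2)(c² + 1/2).
  linear_combination (4 * g x x ^ 2) * (c ^ 2 + 1 / 2) * hc

/-- A complex line for `K` is spanned by `x` and `K x`. -/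
lemma exists_of_mem_line {L : Submodule ℝ V}
    (hL : Module.finrank ℝ L = 2) (hKL : ∀ v ∈ L, K v ∈ L) {x : V} (hx : x ∈ L)
    (hx1 : g x x = 1) {c : ℝ} {w : V} (hw : w ∈ L)
    (hw1 : g (c • (w + K w)) (c • (w + K w)) = 1) :
    ∃ a b : ℝ, a ^ 2 + b ^ 2 = 1 ∧ c • (w + K w) = a • x + b • K x := by
  have e1 : g (K x) x = 0 := by rw [h.symm, h.self₂]
  have hli : LinearIndependent ℝ ![x, K x] := by
    rw [LinearIndependent.pair_iff]
    intro a b hab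
    have hz (v : V) : g 0 v = 0 := by rw [← zero_smul ℝ (0 : V), h.smul_left, zero_mul]
    have h1 : g (a • x + b • K x) x = 0 := by rw [hab, hz]
    have h2 : g (a • x + b • K x) (K x) = 0 := by rw [hab, hz]
    simp only [h.add_left, h.smul_left, hx1, e1, h.isometry₂, h.self₂] at h1 h2
    constructor <;> linarith
  have hspan : Submodule.span ℝ {x, K x} = L := by
    have hfin : Module.Finite ℝ L := Module.finite_of_finrank_pos (by omega)
    refine Submodule.eq_of_le_of_finrank_eq ?_ ?_
    · rw [Submodule.span_le]
      rintro v (rfl | rfl)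
      · exact hx
      · exact hKL _ hx
    · rw [hL]
      have := finrank_span_eq_card hli
      rwa [Matrix.range_cons_cons_empty, Fintype.card_fin] at this
  -- K-invariance of `L` puts the image vector back in `L`; orthonormality of x, Kx then gives a² +
  -- b² = 1.
  have hmem : c • (w + K w) ∈ Submodule.span ℝ {x, K x} := by
    rw [hspan]
    exact L.smul_mem _ (L.add_mem hw (hKL _ hw))
  obtain ⟨a, b, hab⟩ := Submodule.mem_span_pair.1 hmem
  refine ⟨a, b, ?_, hab.symm⟩
  rw [← hab] at hw1
  simp only [h.add_left, h.add_right, h.smul_left, h.smul_right, hx1, e1, h.isometry₂, h.self₂]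
    at hw1
  linarith

end QuaternionicData

end Algebra

/-! ### The three assertions -/

variable {n : ℕ} (P : AffineCP (2 * n))

theorem quaternionicData : QuaternionicData (V := Tan P)
    (fun u v ↦ (fubiniStudy (2 * n)).inner P u v) (standardJ (2 * n) P) (quaternionJ₂ n P) where
  add_left x y w := by simp
  smul_left c x w := by simp
  symm x y := (fubiniStudy (2 * n)).symm P x y
  map_add₁ x y := map_add _ x y
  map_smul₁ c x := map_smul _ c x
  map_add₂ x y := map_add _ x y
  map_smul₂ c x := map_smul _ c x
  sq₁ x := (standardJ (2 * n)).sq P x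
  sq₂ x := (quaternionJ₂ n).sq P x
  isometry₁ x y := (standardJ (2 * n)).isometry P x y
  isometry₂ x y := (quaternionJ₂ n).isometry P x y
  anticomm x := by
    rw [(isQuaternionStructure n P x).1, (isQuaternionStructure n P x).2]

lemma quaternionTheta_apply (v : Tan P) :
    quaternionTheta n P v = (Real.sqrt 2)⁻¹ • (v + quaternionJ₂ n P v) := rfl

lemma inv_sqrt_two_sq : ((Real.sqrt 2)⁻¹) ^ 2 = (1 / 2 : ℝ) := by
  rw [inv_pow, Real.sq_sqrt (by norm_num)]; norm_num

variable {P}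

/-- Because Θ maps `L` into itself, independently chosen unit vectors of `L` and of its image differ
by a rotation in the plane, which the operators do not see. -/
lemma exists_eq_rotate {L : Submodule ℝ (Tan P)} (hL : IsComplexLine (quaternionJ₂ n) P L)
    {x x' : Tan P} (hx : x ∈ unitVectors (fubiniStudy (2 * n)) L)
    (hx' : x' ∈ unitVectors (fubiniStudy (2 * n)) (L.map (quaternionTheta n P).toLinearMap)) :
    ∃ a b : ℝ, a ^ 2 + b ^ 2 = 1 ∧ x' = a • x + b • quaternionJ₂ n P x := by
  obtain ⟨⟨w, hw, rfl⟩, hx1⟩ := hx'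
  have hKL : ∀ v ∈ L, quaternionJ₂ n P v ∈ L := fun v hv ↦ by
    have h := Submodule.mem_map_of_mem (f := (quaternionJ₂ n P).toLinearMap) hv
    rw [hL.2] at h
    exact h
  exact (quaternionicData P).exists_of_mem_line hL.1 hKL hx.1 hx.2 hw hx1

lemma curvature_eq_holomorphicCurvature (x y w : Tan P) :
    curvature (fubiniStudyConnection (2 * n)) x y w =
      holomorphicCurvature (fun u v ↦ (fubiniStudy (2 * n)).inner P u v) (standardJ (2 * n) P)
        x y w :=
  curvature_fubiniStudyConnection P x y w

theorem quaternionTheta_complexJacobi {L : Submodule ℝ (Tan P)}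
    (hL : IsComplexLine (quaternionJ₂ n) P L)
    {x x' : Tan P} (hx : x ∈ unitVectors (fubiniStudy (2 * n)) L)
    (hx' : x' ∈ unitVectors (fubiniStudy (2 * n)) (L.map (quaternionTheta n P).toLinearMap))
    (y : Tan P) :
    quaternionTheta n P (complexJacobi (quaternionJ₂ n) (fubiniStudyConnection (2 * n)) x y) =
      complexJacobi (quaternionJ₂ n) (fubiniStudyConnection (2 * n)) x'
        (quaternionTheta n P y) := by
  have h := quaternionicData P
  obtain ⟨a, b, hab, rfl⟩ := exists_eq_rotate hL hx hx'
  simp only [complexJacobi, jacobi, curvature_eq_holomorphicCurvature]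
  rw [h.complexJacobi_eq hx'.2, h.complexJacobi_rotate hab, ← h.complexJacobi_eq hx.2,
    quaternionTheta_apply, quaternionTheta_apply, h.complexJacobi_commutes hx.2]
  simp only [h.holomorphicCurvature_smul_left, h.holomorphicCurvature_add_left]
  module

theorem quaternionTheta_complexCurvature {L : Submodule ℝ (Tan P)}
    (hL : IsComplexLine (quaternionJ₂ n) P L)
    {x x' : Tan P} (hx : x ∈ unitVectors (fubiniStudy (2 * n)) L)
    (hx' : x' ∈ unitVectors (fubiniStudy (2 * n)) (L.map (quaternionTheta n P).toLinearMap))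
    (y : Tan P) :
    quaternionTheta n P (complexCurvature (quaternionJ₂ n) (fubiniStudyConnection (2 * n)) x y) =
      complexCurvature (quaternionJ₂ n) (fubiniStudyConnection (2 * n)) x'
        (quaternionTheta n P y) := by
  have h := quaternionicData P
  obtain ⟨a, b, hab, rfl⟩ := exists_eq_rotate hL hx hx'
  simp only [complexCurvature, curvature_eq_holomorphicCurvature]
  rw [h.complexCurvature_rotate hab, quaternionTheta_apply, quaternionTheta_apply,
    h.complexCurvature_commutes, h.holomorphicCurvature_smul, h.holomorphicCurvature_add]

theorem quaternionTheta_pullback_ne (hn : 0 < n) :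
    (fun x y z w : Tan P ↦ curvatureTensor (fubiniStudy (2 * n)) (fubiniStudyConnection (2 * n)) P
      (quaternionTheta n P x) (quaternionTheta n P y) (quaternionTheta n P z)
      (quaternionTheta n P w)) ≠
    curvatureTensor (fubiniStudy (2 * n)) (fubiniStudyConnection (2 * n)) P := by
  intro heq
  have h := quaternionicData P
  obtain ⟨x, hx⟩ : ∃ x : Tan P, x ≠ 0 := by
    refine ⟨(tangentEquiv P).symm (EuclideanSpace.single ⟨0, by omega⟩ 1), ?_⟩
    simp
  have hpos := (fubiniStudy (2 * n)).pos P x hx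
  -- Evaluating at (x, J₁x, J₁x, x) compares g(x, x)² with 4g(x, x)².
  have h1 := congrFun (congrFun (congrFun (congrFun heq x) (standardJ (2 * n) P x))
    (standardJ (2 * n) P x)) x
  simp only [curvatureTensor, curvature_eq_holomorphicCurvature, quaternionTheta_apply] at h1
  have h2 := h.sectional_twisted x inv_sqrt_two_sq
  have h3 := h.sectional_eq x
  have h4 := h2.symm.trans (h1.trans h3)
  have := pow_pos hpos 2
  linarith

end AlmostHermitian

end

/-- For every positive `m ≡ 0 mod 4`, say `m = 4 n`, the manifold `M = ℂP²ⁿ - ℂP²ⁿ⁻¹` of real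
dimension `m` with the Fubini–Study metric `g` carries a global unitary quaternion structure
`{J₁, J₂, J₃}`, with `J₁` the standard complex structure, such that the almost Hermitian manifold
`(M, g, J₂)` and the smooth section `Θ = (1 + J₂) / √2` of its bundle of complex isometries satisfy
the three assertions at every point: `Θ` intertwines the complex Jacobi operators, `Θ` intertwines
the complex curvature operators, but `Θ^* R ≠ R`. -/
theorem theorem1p6 (m : ℕ) (hm : 0 < m) (hm4 : m ≡ 0 [MOD 4]) :
    ∃ n : ℕ, m = 4 * n ∧ Module.finrank ℝ (Cplx (2 * n)) = m ∧
    ∃ (J₂ J₃ : UnitaryAlmostComplexStructure (fubiniStudy (2 * n)))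
      (Θ : ComplexIsometryField J₂)
      (cov : Connection 𝓘(ℝ, Cplx (2 * n)) (AffineCP (2 * n))),
      IsQuaternionStructure (standardJ (2 * n)) J₂ J₃ ∧
      (∀ (P : AffineCP (2 * n)) (v : Tan P),
        Θ P v = (Real.sqrt 2)⁻¹ • (v + J₂ P v)) ∧
      IsLeviCivita (fubiniStudy (2 * n)) cov ∧
      ∀ P : AffineCP (2 * n),
        (∀ L : Submodule ℝ (Tan P), IsComplexLine J₂ P L →
          ∀ x ∈ unitVectors (fubiniStudy (2 * n)) L,
          ∀ x' ∈ unitVectors (fubiniStudy (2 * n)) (L.map (Θ P).toLinearMap),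
          ∀ y : Tan P,
            Θ P (complexJacobi J₂ cov x y) =
              complexJacobi J₂ cov x' (Θ P y)) ∧
        (∀ L : Submodule ℝ (Tan P), IsComplexLine J₂ P L →
          ∀ x ∈ unitVectors (fubiniStudy (2 * n)) L,
          ∀ x' ∈ unitVectors (fubiniStudy (2 * n)) (L.map (Θ P).toLinearMap),
          ∀ y : Tan P,
            Θ P (complexCurvature J₂ cov x y) =
              complexCurvature J₂ cov x' (Θ P y)) ∧
        (fun x y z w : Tan P ↦
            curvatureTensor (fubiniStudy (2 * n)) cov P
              (Θ P x) (Θ P y) (Θ P z) (Θ P w)) ≠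
          curvatureTensor (fubiniStudy (2 * n)) cov P := by
  have h4 : 4 ∣ m := Nat.dvd_of_mod_eq_zero hm4
  obtain ⟨n, rfl⟩ := h4
  have hfin : Module.finrank ℝ (Cplx (2 * n)) = 4 * n := by
    rw [← Module.finrank_mul_finrank ℝ ℂ, Complex.finrank_real_complex, finrank_euclideanSpace_fin]
    ring
  exact ⟨n, rfl, hfin, quaternionJ₂ n, quaternionJ₃ n, quaternionTheta n,
    fubiniStudyConnection (2 * n), isQuaternionStructure n, quaternionTheta_apply,
    isLeviCivita_fubiniStudyConnection (2 * n), fun P ↦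
      ⟨fun _ hL _ hx _ hx' ↦ quaternionTheta_complexJacobi hL hx hx',
        fun _ hL _ hx _ hx' ↦ quaternionTheta_complexCurvature hL hx hx',
        quaternionTheta_pullback_ne (by omega)⟩⟩
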